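/- Let $(X,Y)$ be a random vector, with $X$ real valued and $Y\ge 0$ almost surely. Let $0<\alpha<1$ and suppose that $Y$ has a regularly varying tail with index $\alpha$: $P(Y>t)>0$ for large $t$ and $P(Y>ty)/P(Y>t)\to y^{-\alpha}$ as $t\to\infty$ for every $y>0$. Let $d_0=0$, let $(d_n)_{n\ge1}$ be a strictly positive sequence with $nP(Y>d_n)\to1$, put $d(t)=d_{\lfloor t\rfloor}$ (with $d(t)=0$ for $t<0$), and let $\widetilde d:\mathbb R\to\mathbb R$ be an asymptotic inverse of $d$, that is, $d(\widetilde d(t))\sim\widetilde d(d(t))\sim t$ as $t\to\infty$. Let $a,b:\mathbb R\to\mathbb R$ be functions with $a(t)>0$ for all large $t$. For $t>0$ put $$\widetilde X_t=\frac{X-b(\widetilde d(t))}{a(\widetilde d(t))},\qquad \widetilde Y_t=\frac{Y}{t}.$$ Suppose that $X$ belongs to the maximum domain of attraction of $G_1$ with norming functions $a,b$, that is, $tP(X>a(t)x+b(t))\to-\log G_1(x)$ as $t\to\infty$ for every real $x$ with $G_1(x)>0$, in one of the following two cases. (i) Gumbel case: $G_1(x)=\Lambda(x)=\exp(-e^{-x})$,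 with state space $\mathbb E=[-\infty,\infty]\times[0,\infty]\setminus\{(-\infty,0)\}$. Here $\mu_0$ is the measure on $\mathbb E$, concentrated on the axes $\mathbb R\times\{0\}$ and $\{-\infty\}\times(0,\infty)$, with $\mu_0\big(([-\infty,x]\times[0,y])^c\big)=e^{-x}+y^{-\alpha}$ for $x\in\mathbb R$, $y>0$. (ii) Fréchet case: $G_1(x)=\Phi_\beta(x)=\exp(-x^{-\beta})$ for $x>0$ and $\Phi_\beta(x)=0$ for $x\le0$, where $\beta>0$, with state space $\mathbb E=[0,\infty]\times[0,\infty]\setminus\{(0,0)\}$. Here $\mu_0$ is the measure on $\mathbb E$, concentrated on the axes $(0,\infty)\times\{0\}$ and $\{0\}\times(0,\infty)$, with $\mu_0\big(([0,x]\times[0,y])^c\big)=x^{-\beta}+y^{-\alpha}$ for $x,y>0$. In this case $\widetilde X_t$ is read as a point of $[0,\infty]$, negative values being identified with $0$ (this changes nothing if $X\ge0$ and $b=0$). Let $U_X=1/(1-F_X)$ and $U_Y=1/(1-F_Y)$, where $F_X,F_Y$ are the distribution functions of $X$ and $Y$ and $1/0=\infty$, and let $U^{\leftarrow}(x)=\inf\{s\in\mathbb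 R:U(s)>x\}$. Then, in each of the two cases, $$\widetilde d(t)\,P\big((\widetilde X_t,\widetilde Y_t)\in\cdot\,\big)\ \xrightarrow{\ v\ }\ \mu_0\qquad\text{as }t\to\infty\text{, vaguely on }\mathbb E$$ (the left-hand side being restricted to $\mathbb E$; vague convergence means convergence of the integrals of all continuous real functions on $\mathbb E$ with compact support), if and only if $$\lim_{x\to\infty}P\big(X>U_X^{\leftarrow}(x)\,\big|\,Y>U_Y^{\leftarrow}(x)\big)=0.$$ -/

import Mathlib

open MeasureTheory ProbabilityTheory Filter Topology Set Asymptotics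
open scoped ENNReal CompactlySupported

noncomputable section

namespace TailIndependence

/-- `f` is regularly varying at infinity with index `ρ`. -/
def IsRegularlyVarying (f : ℝ → ℝ) (ρ : ℝ) : Prop :=
  (∀ᶠ t in atTop, 0 < f t) ∧
    ∀ y : ℝ, 0 < y → Tendsto (fun t => f (t * y) / f t) atTop (𝓝 (y ^ ρ))

/-- The Gumbel distribution function `Λ`. -/
def gumbelCDF (x : ℝ) : ℝ := Real.exp (-Real.exp (-x))

/-- The Fréchet distribution function `Φ_β`. -/
def frechetCDF (β x : ℝ) : ℝ := if 0 < x then Real.exp (-x ^ (-β)) else 0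

/-- `X` is in the maximum domain of attraction of `G`, with norming functions `a` and `b`:
`t P(X > a(t) x + b(t)) → -log G(x)` as `t → ∞`. Where `G x = 0` the limit `-log G(x)` is `+∞`;
for the Fréchet law that part follows from the rest by monotonicity in `x`. -/
def IsMDANorming {Ω : Type*} [MeasurableSpace Ω] (P : Measure Ω) (X : Ω → ℝ) (G a b : ℝ → ℝ) :
    Prop :=
  (∀ᶠ t in atTop, 0 < a t) ∧
    ∀ x : ℝ, 0 < G x →
      Tendsto (fun t : ℝ => t * P.real {ω | a t * x + b t < X ω}) atTop (𝓝 (-Real.log (G x)))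

/-- The function `U = 1 / (1 - F)`, where `F` is the distribution function of `X`; it takes the
value `∞` where `F = 1`. -/
def tailRecip {Ω : Type*} [MeasurableSpace Ω] (P : Measure Ω) (X : Ω → ℝ) (s : ℝ) : ℝ≥0∞ :=
  1 / (1 - P {ω | X ω ≤ s})

/-- The right-continuous generalized inverse `U^←(x) = inf {s : U(s) > x}`. -/
def tailQuantile {Ω : Type*} [MeasurableSpace Ω] (P : Measure Ω) (X : Ω → ℝ) (x : ℝ) : ℝ :=
  sInf {s : ℝ | ENNReal.ofReal x < tailRecip P X s}

/-- Asymptotic tail independence: `P(X > U_X^←(x) | Y > U_Y^←(x)) → 0` as `x → ∞`. -/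
def IsAsymptoticallyTailIndependent {Ω : Type*} [MeasurableSpace Ω] (P : Measure Ω)
    (X Y : Ω → ℝ) : Prop :=
  Tendsto (fun x : ℝ => P[{ω | tailQuantile P X x < X ω} | {ω | tailQuantile P Y x < Y ω}])
    atTop (𝓝 0)

/-- Vague convergence of measures: convergence of the integrals of all continuous functions with
compact support. -/
def TendstoVaguely {ι E : Type*} [TopologicalSpace E] [MeasurableSpace E]
    (ν : ι → Measure E) (l : Filter ι) (μ : Measure E) : Prop :=
  ∀ f : C_c(E, ℝ), Tendsto (fun i => ∫ z, f z ∂(ν i)) l (𝓝 (∫ z, f z ∂μ))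

/-- The state space `[-∞,∞] × [0,∞] \ {(-∞,0)}` of the Gumbel case. -/
abbrev GumbelSpace : Type := {p : EReal × ℝ≥0∞ // p ≠ (⊥, 0)}

/-- The state space `[0,∞] × [0,∞] \ {(0,0)}` of the Fréchet case. -/
abbrev FrechetSpace : Type := {p : ℝ≥0∞ × ℝ≥0∞ // p ≠ (0, 0)}

/-- The measure `e^{-x} dx` on `ℝ`. -/
def expMeasure : Measure ℝ := volume.withDensity (fun x => ENNReal.ofReal (Real.exp (-x)))

/-- The measure `γ x^{-γ-1} dx` on `(0,∞)`, as a measure on `ℝ`. -/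
def powerMeasure (γ : ℝ) : Measure ℝ :=
  (volume.restrict (Ioi 0)).withDensity (fun x => ENNReal.ofReal (γ * x ^ (-γ - 1)))

/-- The exponent measure `μ₀` of the Gumbel case, concentrated on the two axes
`ℝ × {0}` and `{-∞} × (0,∞)`. -/
def gumbelExponentMeasure (α : ℝ) : Measure GumbelSpace :=
  (expMeasure.map (fun x : ℝ => ((x : EReal), (0 : ℝ≥0∞))) +
    (powerMeasure α).map (fun y : ℝ => ((⊥ : EReal), ENNReal.ofReal y))).comap Subtype.val

/-- The exponent measure `μ₀` of the Fréchet case, concentrated on the two axes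
`(0,∞) × {0}` and `{0} × (0,∞)`. -/
def frechetExponentMeasure (β α : ℝ) : Measure FrechetSpace :=
  ((powerMeasure β).map (fun x : ℝ => (ENNReal.ofReal x, (0 : ℝ≥0∞))) +
    (powerMeasure α).map (fun y : ℝ => ((0 : ℝ≥0∞), ENNReal.ofReal y))).comap Subtype.val

lemma expMeasure_Ioi (x : ℝ) : expMeasure (Ioi x) = ENNReal.ofReal (Real.exp (-x)) := by
  rw [expMeasure, withDensity_apply _ measurableSet_Ioi,
    ← ofReal_integral_eq_lintegral_ofReal (integrableOn_exp_neg_Ioi x)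
      (Eventually.of_forall fun _ => (Real.exp_pos _).le), integral_exp_neg_Ioi]

lemma powerMeasure_Ioi {γ x : ℝ} (hγ : 0 < γ) (hx : 0 < x) :
    powerMeasure γ (Ioi x) = ENNReal.ofReal (x ^ (-γ)) := by
  have hi : IntegrableOn (fun t : ℝ => γ * t ^ (-γ - 1)) (Ioi x) :=
    (integrableOn_Ioi_rpow_of_lt (by linarith) hx).const_mul γ
  rw [powerMeasure, withDensity_apply _ measurableSet_Ioi,
    Measure.restrict_restrict measurableSet_Ioi,
    inter_eq_left.2 (Ioi_subset_Ioi hx.le), ← ofReal_integral_eq_lintegral_ofReal hi,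
    integral_const_mul, integral_Ioi_rpow_of_lt (by linarith) hx]
  · congr 1
    rw [sub_add_cancel]
    field_simp
  · filter_upwards [ae_restrict_mem measurableSet_Ioi] with t ht
    have : 0 < t := hx.trans ht
    positivity

/-- The exponent measure of the Gumbel case satisfies
`μ₀(([-∞,x] × [0,y])ᶜ) = e^{-x} + y^{-α}`. -/
lemma gumbelExponentMeasure_compl_box {α x y : ℝ} (hα : 0 < α) (hy : 0 < y) :
    gumbelExponentMeasure α {p | p.1.1 ≤ (x : EReal) ∧ p.1.2 ≤ ENNReal.ofReal y}ᶜ =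
      ENNReal.ofReal (Real.exp (-x)) + ENNReal.ofReal (y ^ (-α)) := by
  have hE : MeasurableSet {p : EReal × ℝ≥0∞ | p ≠ (⊥, 0)} :=
    (measurableSet_singleton _).compl
  have hB : MeasurableSet {p : EReal × ℝ≥0∞ | p.1 ≤ (x : EReal) ∧ p.2 ≤ ENNReal.ofReal y} :=
    (measurableSet_le measurable_fst measurable_const).inter
      (measurableSet_le measurable_snd measurable_const)
  have himg : (Subtype.val '' ({p : GumbelSpace | p.1.1 ≤ (x : EReal) ∧
      p.1.2 ≤ ENNReal.ofReal y}ᶜ) : Set (EReal × ℝ≥0∞)) =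
      {p : EReal × ℝ≥0∞ | p.1 ≤ (x : EReal) ∧ p.2 ≤ ENNReal.ofReal y}ᶜ := by
    ext p
    simp only [mem_image, mem_compl_iff, mem_ofPred_eq, Subtype.exists, exists_and_right,
      exists_eq_right]
    constructor
    · rintro ⟨_, h⟩
      exact h
    · intro h
      refine ⟨?_, h⟩
      rintro rfl
      exact h ⟨bot_le, zero_le⟩
  have hm1 : Measurable (fun x : ℝ => ((x : EReal), (0 : ℝ≥0∞))) :=
    measurable_coe_real_ereal.prodMk measurable_const
  have hm2 : Measurable (fun y : ℝ => ((⊥ : EReal), ENNReal.ofReal y)) :=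
    measurable_const.prodMk ENNReal.measurable_ofReal
  have he : MeasurableEmbedding (Subtype.val : GumbelSpace → EReal × ℝ≥0∞) :=
    MeasurableEmbedding.subtype_coe hE
  rw [gumbelExponentMeasure, he.comap_apply, himg,
    Measure.add_apply, Measure.map_apply hm1 hB.compl, Measure.map_apply hm2 hB.compl,
    ← expMeasure_Ioi, ← powerMeasure_Ioi hα hy]
  congr 2
  · ext t
    simp
  · ext t
    simp [ENNReal.ofReal_le_ofReal_iff hy.le]

/-- The exponent measure of the Fréchet case satisfies
`μ₀(([0,x] × [0,y])ᶜ) = x^{-β} + y^{-α}`. -/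
lemma frechetExponentMeasure_compl_box {β α x y : ℝ} (hβ : 0 < β) (hα : 0 < α)
    (hx : 0 < x) (hy : 0 < y) :
    frechetExponentMeasure β α {p | p.1.1 ≤ ENNReal.ofReal x ∧ p.1.2 ≤ ENNReal.ofReal y}ᶜ =
      ENNReal.ofReal (x ^ (-β)) + ENNReal.ofReal (y ^ (-α)) := by
  have hE : MeasurableSet {p : ℝ≥0∞ × ℝ≥0∞ | p ≠ (0, 0)} :=
    (measurableSet_singleton _).compl
  have hB : MeasurableSet
      {p : ℝ≥0∞ × ℝ≥0∞ | p.1 ≤ ENNReal.ofReal x ∧ p.2 ≤ ENNReal.ofReal y} :=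
    (measurableSet_le measurable_fst measurable_const).inter
      (measurableSet_le measurable_snd measurable_const)
  have himg : (Subtype.val '' ({p : FrechetSpace | p.1.1 ≤ ENNReal.ofReal x ∧
      p.1.2 ≤ ENNReal.ofReal y}ᶜ) : Set (ℝ≥0∞ × ℝ≥0∞)) =
      {p : ℝ≥0∞ × ℝ≥0∞ | p.1 ≤ ENNReal.ofReal x ∧ p.2 ≤ ENNReal.ofReal y}ᶜ := by
    ext p
    simp only [mem_image, mem_compl_iff, mem_ofPred_eq, Subtype.exists, exists_and_right,
      exists_eq_right]
    constructor
    · rintro ⟨_, h⟩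
      exact h
    · intro h
      refine ⟨?_, h⟩
      rintro rfl
      exact h ⟨zero_le, zero_le⟩
  have hm1 : Measurable (fun x : ℝ => (ENNReal.ofReal x, (0 : ℝ≥0∞))) :=
    ENNReal.measurable_ofReal.prodMk measurable_const
  have hm2 : Measurable (fun y : ℝ => ((0 : ℝ≥0∞), ENNReal.ofReal y)) :=
    measurable_const.prodMk ENNReal.measurable_ofReal
  have he : MeasurableEmbedding (Subtype.val : FrechetSpace → ℝ≥0∞ × ℝ≥0∞) :=
    MeasurableEmbedding.subtype_coe hE
  rw [frechetExponentMeasure, he.comap_apply, himg,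
    Measure.add_apply, Measure.map_apply hm1 hB.compl, Measure.map_apply hm2 hB.compl,
    ← powerMeasure_Ioi hβ hx, ← powerMeasure_Ioi hα hy]
  congr 2
  · ext t
    simp [ENNReal.ofReal_le_ofReal_iff hx.le]
  · ext t
    simp [ENNReal.ofReal_le_ofReal_iff hy.le]

/-- The measure `m · P((Z, W) ∈ ·)` on the Gumbel state space. -/
def gumbelScaledLaw {Ω : Type*} [MeasurableSpace Ω] (P : Measure Ω) (m : ℝ) (Z W : Ω → ℝ) :
    Measure GumbelSpace :=
  ENNReal.ofReal m •
    (P.map (fun ω => ((Z ω : EReal), ENNReal.ofReal (W ω)))).comap Subtype.val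

/-- The measure `m · P((Z, W) ∈ ·)` on the Fréchet state space. A negative value of `Z` is
identified with the left end point `0` of `[0,∞]` (`ENNReal.ofReal` is the positive part); this has
no effect when `Z` is nonnegative. The excluded corner `(0,0)` carries no mass by restriction. -/
def frechetScaledLaw {Ω : Type*} [MeasurableSpace Ω] (P : Measure Ω) (m : ℝ) (Z W : Ω → ℝ) :
    Measure FrechetSpace :=
  ENNReal.ofReal m •
    (P.map (fun ω => (ENNReal.ofReal (Z ω), ENNReal.ofReal (W ω)))).comap Subtype.val

end TailIndependence

end

namespace TailIndependence

/-! Write `m` for the asymptotic inverse of `d` at `t`. Regular variation together with `n P(Y > d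
n) → 1` gives `m P(Y > t y) → y ^ (-α)`, and the domain-of-attraction hypothesis, read along `m →
∞`, gives the corresponding limit for `X`. So both marginals converge unconditionally, and only the
joint behaviour is at stake.

Split a test function `F` into its restrictions to the two axes plus a remainder. The marginals
settle the restrictions. The remainder vanishes on both axes, hence is small unless both coordinates
exceed fixed levels. Vague convergence to a measure on the axes is therefore the same as `m P(both
exceed) → 0` for all levels (`tendstoVaguely_axes_iff`); the converse direction is tested with
Urysohn bumps.

What remains is to compare normalizing levels with quantiles (`joint_exceedance_iff`). Along `s = c
* m` with small `c`, both levels lie above the quantiles at `s`; along `t = U_Y^←(s)`, a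
sufficiently low `X`-level lies below `U_X^←(s)`. Monotonicity of joint exceedances gives each
implication. Both state spaces are treated at once through `IsAxisChart`. -/

/-! ### Convergence of scaled integrals from scaled tails on the line. -/

lemma probabilityMeasure_tendsto_of_tendsto_Ioi {ι : Type*} {l : Filter ι}
    [l.IsCountablyGenerated] {μ : ι → ProbabilityMeasure ℝ} {ν : ProbabilityMeasure ℝ}
    (h : ∀ x, Tendsto (fun i => (μ i : Measure ℝ).real (Ioi x)) l
      (𝓝 ((ν : Measure ℝ).real (Ioi x)))) :
    Tendsto μ l (𝓝 ν) := by
  have hIoc : ∀ (ρ : ProbabilityMeasure ℝ) (a b : ℝ), a ≤ b →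
      (ρ : Measure ℝ).real (Ioc a b) = (ρ : Measure ℝ).real (Ioi a) -
        (ρ : Measure ℝ).real (Ioi b) := by
    intro ρ a b hab
    rw [← measureReal_sdiff (Ioi_subset_Ioi hab) measurableSet_Ioi]
    congr 1
    ext z
    simp
  -- Tails converge at every point, so the half-open intervals, a π-system containing small
  -- neighbourhoods of each point, suffice without discarding atoms of the limit.
  refine IsPiSystem.tendsto_probabilityMeasure_of_tendsto_of_mem
    (isPiSystem_Ioc (id : ℝ → ℝ) (id : ℝ → ℝ)) ?_ ?_ ?_
  · rintro s ⟨a, b, -, rfl⟩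
    exact measurableSet_Ioc
  · intro u hu x hx
    obtain ⟨ε, hε, hb⟩ := Metric.isOpen_iff.1 hu x hx
    refine ⟨Ioc (x - ε / 2) (x + ε / 2), ⟨_, _, by simp only [id]; linarith, rfl⟩,
      Ioc_mem_nhds (by linarith) (by linarith), fun z hz => hb ?_⟩
    rw [Metric.mem_ball, Real.dist_eq, abs_lt]
    constructor <;> linarith [hz.1, hz.2]
  · rintro s ⟨a, b, hab, rfl⟩
    rw [← NNReal.tendsto_coe]
    have := (h a).sub (h b)
    simp only [id] at hab ⊢
    rw [← hIoc ν a b hab.le] at this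
    refine this.congr fun i => ?_
    rw [← hIoc (μ i) a b hab.le]
    rfl

/-- Convergence of scaled tails above a level implies convergence of the scaled integrals of
bounded continuous functions that vanish below that level. -/
lemma tendsto_mul_integral_of_tendsto_tail {ι : Type*} {l : Filter ι} [l.IsCountablyGenerated]
    {m : ι → ℝ} {p : ι → Measure ℝ} [∀ i, IsProbabilityMeasure (p i)] {μ : Measure ℝ} {x₀ : ℝ}
    (h0 : μ (Ioi x₀) ≠ 0) (hfin : μ (Ioi x₀) ≠ ∞)
    (h : ∀ x, x₀ ≤ x → Tendsto (fun i => m i * (p i).real (Ioi x)) l (𝓝 (μ.real (Ioi x))))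
    (g : BoundedContinuousFunction ℝ ℝ) (hg : ∀ x ≤ x₀, g x = 0) :
    Tendsto (fun i => m i * ∫ x, g x ∂(p i)) l (𝓝 (∫ x, g x ∂μ)) := by
  have hμpos : 0 < μ.real (Ioi x₀) := ENNReal.toReal_pos h0 hfin
  have hp0 : ∀ᶠ i in l, 0 < m i * (p i).real (Ioi x₀) :=
    (h x₀ le_rfl).eventually_const_lt hμpos
  have hν : IsProbabilityMeasure (μ[|Ioi x₀]) := cond_isProbabilityMeasure_of_finite h0 hfin
  -- Conditioning on a null set gives the zero measure, so an arbitrary probability measure is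
  -- substituted there; this happens only outside an eventual set.
  have hq : ∀ i, ∃ q : ProbabilityMeasure ℝ,
      (p i).real (Ioi x₀) ≠ 0 → (q : Measure ℝ) = (p i)[|Ioi x₀] := by
    intro i
    by_cases hi : (p i).real (Ioi x₀) = 0
    · exact ⟨⟨p i, inferInstance⟩, fun h => (h hi).elim⟩
    · refine ⟨⟨_, cond_isProbabilityMeasure (μ := p i) (s := Ioi x₀) fun h => hi ?_⟩, fun _ => rfl⟩
      simp [measureReal_def, h]
  choose q hq using hq
  -- As `g` vanishes below the level, its integral is the mass above the level times a conditional
  -- mean. This reduces the claim to weak convergence of conditional laws.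
  have key : ∀ (ρ : Measure ℝ), ρ (Ioi x₀) ≠ ∞ → ρ.real (Ioi x₀) ≠ 0 →
      ∫ x, g x ∂ρ = ρ.real (Ioi x₀) * ∫ x, g x ∂(ρ[|Ioi x₀]) := by
    intro ρ hρ h0
    rw [ProbabilityTheory.cond, integral_smul_measure, ENNReal.toReal_inv,
      setIntegral_eq_integral_of_forall_compl_eq_zero (s := Ioi x₀) (fun x hx => hg x (not_lt.1 (by simpa using hx))), smul_eq_mul,
      ← mul_assoc, ← measureReal_def, mul_inv_cancel₀ h0, one_mul]
  have hcond : ∀ (ρ : Measure ℝ) (x : ℝ), ρ (Ioi x₀) ≠ ∞ →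
      (ρ[|Ioi x₀]).real (Ioi x) = (ρ.real (Ioi x₀))⁻¹ * ρ.real (Ioi (max x₀ x)) := by
    intro ρ x hρ
    rw [measureReal_def, cond_apply measurableSet_Ioi, Ioi_inter_Ioi, ENNReal.toReal_mul,
      ENNReal.toReal_inv]
    rfl
  have hlim : Tendsto q l (𝓝 ⟨_, hν⟩) := by
    refine probabilityMeasure_tendsto_of_tendsto_Ioi fun x => ?_
    simp only [ProbabilityMeasure.coe_mk]
    rw [hcond μ x hfin]
    refine (((h x₀ le_rfl).inv₀ hμpos.ne').mul (h (max x₀ x) (le_max_left _ _))).congr' ?_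
    filter_upwards [hp0] with i hi
    have h1 := right_ne_zero_of_mul hi.ne'
    have h2 := left_ne_zero_of_mul hi.ne'
    rw [hq i h1, hcond _ x (measure_ne_top _ _)]
    field_simp
  have := (h x₀ le_rfl).mul ((ProbabilityMeasure.tendsto_iff_forall_integral_tendsto.1 hlim) g)
  rw [ProbabilityMeasure.coe_mk, ← key μ hfin hμpos.ne'] at this
  refine this.congr' ?_
  filter_upwards [hp0] with i hi
  have h1 := right_ne_zero_of_mul hi.ne'
  rw [hq i h1, key (p i) (measure_ne_top _ _) h1, mul_assoc]

/-! ### Compact axes charted by the reals. -/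

/-- A monotone parametrization `i : ℝ → A` of an axis by the reals, faithful above each level in
`S`, where the levels in `S` are cofinal towards the bottom of the axis. -/
structure IsAxisChart {A : Type*} [LinearOrder A] [BoundedOrder A] [TopologicalSpace A]
    (i : ℝ → A) (S : Set ℝ) : Prop where
  continuous : Continuous i
  monotone : Monotone i
  bot_lt : ∀ x ∈ S, ⊥ < i x
  exists_lt : ∀ u, ⊥ < u → ∃ x ∈ S, i x < u
  lt_iff : ∀ x ∈ S, ∀ z, i x < i z ↔ x < z
  upper : ∀ x ∈ S, ∀ z, x ≤ z → z ∈ S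

lemma isAxisChart_ereal : IsAxisChart Real.toEReal univ where
  continuous := continuous_coe_real_ereal
  monotone := EReal.coe_strictMono.monotone
  bot_lt x _ := EReal.bot_lt_coe x
  exists_lt u hu := by
    obtain ⟨x, -, hx⟩ := EReal.lt_iff_exists_real_btwn.1 hu
    exact ⟨x, mem_univ _, hx⟩
  lt_iff x _ z := EReal.coe_lt_coe_iff
  upper _ _ _ _ := mem_univ _

/-- Levels must be positive because `ENNReal.ofReal` collapses the nonpositive half-line to the
bottom; above a positive level the order is seen faithfully. -/
lemma isAxisChart_ennreal : IsAxisChart ENNReal.ofReal (Ioi 0) where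
  continuous := ENNReal.continuous_ofReal
  monotone := fun _ _ h => ENNReal.ofReal_le_ofReal h
  bot_lt x hx := ENNReal.ofReal_pos.2 hx
  exists_lt u hu := by
    obtain ⟨x, -, h0, hx⟩ := ENNReal.lt_iff_exists_real_btwn.1 hu
    exact ⟨x, ENNReal.ofReal_pos.1 h0, hx⟩
  lt_iff x hx z := by
    rcases lt_or_ge 0 z with hz | hz
    · exact ENNReal.ofReal_lt_ofReal_iff hz
    · have : ¬ x < z := fun h => absurd (h.trans_le hz) (not_lt.2 (le_of_lt hx))
      simp [ENNReal.ofReal_of_nonpos hz, this]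
  upper x hx z hz := lt_of_lt_of_le hx hz

section Axis

variable {A : Type*} [LinearOrder A] [BoundedOrder A] [TopologicalSpace A] [CompactSpace A]
  {i : ℝ → A} {S : Set ℝ}

/-- The restriction of a continuous function to a charted axis. -/
def IsAxisChart.pullback (hi : IsAxisChart i S) (F : A → ℝ) (hF : Continuous F) :
    BoundedContinuousFunction ℝ ℝ :=
  (BoundedContinuousFunction.mkOfCompact ⟨F, hF⟩).compContinuous ⟨i, hi.continuous⟩

variable {Ω ι : Type*} [MeasurableSpace Ω] {P : Measure Ω} [IsProbabilityMeasure P] {l : Filter ι}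
  {m : ι → ℝ} {Z : ι → Ω → ℝ} {μ : Measure ℝ}

lemma IsAxisChart.tendsto_mul_integral [l.IsCountablyGenerated] (hi : IsAxisChart i S)
    (hZ : ∀ t, Measurable (Z t))
    (h0 : ∀ x ∈ S, μ (Ioi x) ≠ 0) (hfin : ∀ x ∈ S, μ (Ioi x) ≠ ∞)
    (h : ∀ x ∈ S, Tendsto (fun t => m t * P.real {ω | x < Z t ω}) l (𝓝 (μ.real (Ioi x))))
    {F : A → ℝ} (hF : Continuous F) {x₀ : ℝ} (hx₀ : x₀ ∈ S) (hF0 : ∀ u ≤ i x₀, F u = 0) :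
    Tendsto (fun t => m t * ∫ ω, F (i (Z t ω)) ∂P) l (𝓝 (∫ x, F (i x) ∂μ)) := by
  have : ∀ t, IsProbabilityMeasure (P.map (Z t)) := fun t =>
    Measure.isProbabilityMeasure_map (hZ t).aemeasurable
  have key := tendsto_mul_integral_of_tendsto_tail (l := l) (m := m) (p := fun t => P.map (Z t))
    (h0 x₀ hx₀) (hfin x₀ hx₀)
    (fun x hx => ((h x (hi.upper _ hx₀ _ hx))).congr fun t => by
      rw [map_measureReal_apply (hZ t) measurableSet_Ioi]; rfl)
    (hi.pullback F hF) (fun x hx => hF0 _ (hi.monotone hx))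
  refine key.congr fun t => ?_
  rw [integral_map (hZ t).aemeasurable
    (hi.pullback F hF).continuous.stronglyMeasurable.aestronglyMeasurable]
  rfl

lemma IsAxisChart.integrable (hi : IsAxisChart i S) {F : A → ℝ} (hF : Continuous F) {x₀ : ℝ}
    (hF0 : ∀ u ≤ i x₀, F u = 0) (hfin : μ (Ioi x₀) ≠ ∞) :
    Integrable (fun x => F (i x)) μ := by
  have hs : Function.support (fun x => F (i x)) ⊆ Ioi x₀ := by
    intro x hx
    by_contra hlt
    exact hx (hF0 _ (hi.monotone (not_lt.1 hlt)))
  rw [← integrableOn_iff_integrable_of_support_subset hs]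
  have : IsFiniteMeasure (μ.restrict (Ioi x₀)) := ⟨by
    rw [Measure.restrict_apply_univ]; exact hfin.lt_top⟩
  exact (hi.pullback F hF).integrable _

end Axis

/-- Tube lemma: an open set containing the compact fibre over `⊥` contains a whole strip around it.
-/
lemma IsAxisChart.exists_level_abs_lt {A C : Type*} [LinearOrder A] [BoundedOrder A]
    [Nontrivial A] [TopologicalSpace A] [OrderTopology A] [TopologicalSpace C] [CompactSpace C]
    {i : ℝ → A} {S : Set ℝ}
    (hi : IsAxisChart i S) {G : A × C → ℝ} (hG : Continuous G) (hG0 : ∀ v, G (⊥, v) = 0)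
    {ε : ℝ} (hε : 0 < ε) : ∃ x ∈ S, ∀ u ≤ i x, ∀ v, |G (u, v)| < ε := by
  have hopen : IsOpen {p | |G p| < ε} := isOpen_lt hG.abs continuous_const
  obtain ⟨U, V, hU, -, hbU, hV, hUV⟩ := generalized_tube_lemma (isCompact_singleton (x := (⊥ : A)))
    (isCompact_univ (X := C)) hopen (by
      rintro ⟨u, v⟩ ⟨hu, -⟩
      have hu' : u = ⊥ := hu
      simp [hu', hG0, hε])
  obtain ⟨a, ha, haU⟩ := (nhds_bot_basis (α := A)).mem_iff.1 (hU.mem_nhds (hbU rfl))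
  obtain ⟨x, hx, hxa⟩ := hi.exists_lt a ha
  exact ⟨x, hx, fun u hu v => hUV ⟨haU (hu.trans_lt hxa), hV (mem_univ v)⟩⟩

/-! ### Negligibility away from the axes. -/

section Plane

variable {A B : Type*} [LinearOrder A] [BoundedOrder A] [Nontrivial A]
  [TopologicalSpace A] [OrderTopology A] [CompactSpace A]
  [LinearOrder B] [BoundedOrder B] [Nontrivial B]
  [TopologicalSpace B] [OrderTopology B] [CompactSpace B]
  {i : ℝ → A} {S : Set ℝ} {j : ℝ → B} {T : Set ℝ}

variable {Ω ι : Type*} [MeasurableSpace Ω] {P : Measure Ω} [IsProbabilityMeasure P] {l : Filter ι}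
  {m : ι → ℝ} {Z W : ι → Ω → ℝ} {μ ν : Measure ℝ}

/-- The scaled integral of a function vanishing on both axes and near the corner is negligible
when joint exceedances are. -/
lemma tendsto_mul_integral_zero_of_joint (hi : IsAxisChart i S) (hj : IsAxisChart j T)
    (hZ : ∀ t, Measurable (Z t)) (hW : ∀ t, Measurable (W t)) (hm : ∀ᶠ t in l, 0 ≤ m t)
    {x₀ y₀ cX cY : ℝ}
    (hX : Tendsto (fun t => m t * P.real {ω | x₀ < Z t ω}) l (𝓝 cX))
    (hY : Tendsto (fun t => m t * P.real {ω | y₀ < W t ω}) l (𝓝 cY))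
    (hjoint : ∀ x ∈ S, ∀ y ∈ T,
      Tendsto (fun t => m t * P.real {ω | x < Z t ω ∧ y < W t ω}) l (𝓝 0))
    {G : A × B → ℝ} (hG : Continuous G) (hG1 : ∀ v, G (⊥, v) = 0) (hG2 : ∀ u, G (u, ⊥) = 0)
    (hG0 : ∀ u ≤ i x₀, ∀ v ≤ j y₀, G (u, v) = 0) :
    Tendsto (fun t => m t * ∫ ω, G (i (Z t ω), j (W t ω)) ∂P) l (𝓝 0) := by
  obtain ⟨K, hK⟩ : ∃ K, ∀ p, |G p| ≤ K := by
    obtain ⟨K, hK⟩ := isCompact_univ.exists_bound_of_continuousOn hG.continuousOn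
    exact ⟨K, fun p => hK p (mem_univ p)⟩
  have hK0 : 0 ≤ K := (abs_nonneg _).trans (hK (⊥, ⊥))
  rw [Metric.tendsto_nhds]
  intro δ hδ
  -- The absolute value keeps the denominator positive, since no sign of `cX + cY` is assumed; the
  -- summand `K * 0` matches the shape of `hlim`.
  obtain ⟨ε, hε, hεδ⟩ : ∃ ε : ℝ, 0 < ε ∧ ε * cX + ε * cY + K * 0 < δ := by
    refine ⟨δ / (2 * (|cX + cY| + 1)), by positivity, ?_⟩
    have h1 : δ / (2 * (|cX + cY| + 1)) * (cX + cY) ≤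
        δ / (2 * (|cX + cY| + 1)) * (|cX + cY| + 1) :=
      mul_le_mul_of_nonneg_left (by linarith [le_abs_self (cX + cY)]) (by positivity)
    have h2 : δ / (2 * (|cX + cY| + 1)) * (|cX + cY| + 1) = δ / 2 := by field_simp
    linarith
  obtain ⟨x₁, hx₁, h1⟩ := hi.exists_level_abs_lt hG hG1 hε
  obtain ⟨y₁, hy₁, h2⟩ := hj.exists_level_abs_lt (G := fun p : B × A => G (p.2, p.1))
    (by fun_prop) hG2 hε
  have hlim := ((hX.const_mul ε).add (hY.const_mul ε)).add ((hjoint x₁ hx₁ y₁ hy₁).const_mul K)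
  filter_upwards [hm, hlim.eventually_lt_const hεδ] with t hmt ht
  rw [Real.dist_eq, sub_zero, abs_mul, abs_of_nonneg hmt]
  refine lt_of_le_of_lt ?_ ht
  have hA : MeasurableSet {ω | x₀ < Z t ω} := measurableSet_lt measurable_const (hZ t)
  have hB : MeasurableSet {ω | y₀ < W t ω} := measurableSet_lt measurable_const (hW t)
  have hC : MeasurableSet {ω | x₁ < Z t ω ∧ y₁ < W t ω} :=
    (measurableSet_lt measurable_const (hZ t)).inter (measurableSet_lt measurable_const (hW t))
  have hint : ∀ {s : Set Ω} (c : ℝ), MeasurableSet s →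
      Integrable (s.indicator fun _ => c) P := fun c hs => (integrable_const c).indicator hs
  -- Where both coordinates are high, `K` is the bound. Elsewhere the point is near an axis, so `ε`
  -- is, and it is needed only if one coordinate leaves the box on which `G` vanishes.
  have hbound : ∀ ω, ‖G (i (Z t ω), j (W t ω))‖ ≤
      {ω | x₀ < Z t ω}.indicator (fun _ => ε) ω + {ω | y₀ < W t ω}.indicator (fun _ => ε) ω +
        {ω | x₁ < Z t ω ∧ y₁ < W t ω}.indicator (fun _ => K) ω := by
    intro ω
    have hn : 0 ≤ {ω | x₁ < Z t ω ∧ y₁ < W t ω}.indicator (fun _ => K) ω :=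
      indicator_nonneg (fun _ _ => hK0) ω
    have hn1 : 0 ≤ {ω | x₀ < Z t ω}.indicator (fun _ => ε) ω :=
      indicator_nonneg (fun _ _ => hε.le) ω
    have hn2 : 0 ≤ {ω | y₀ < W t ω}.indicator (fun _ => ε) ω :=
      indicator_nonneg (fun _ _ => hε.le) ω
    rw [Real.norm_eq_abs]
    by_cases h3 : x₁ < Z t ω ∧ y₁ < W t ω
    · rw [indicator_of_mem (s := {ω | x₁ < Z t ω ∧ y₁ < W t ω}) h3]
      linarith [hK (i (Z t ω), j (W t ω))]
    have h4 : |G (i (Z t ω), j (W t ω))| ≤ ε := by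
      rw [not_and_or, not_lt, not_lt] at h3
      rcases h3 with h3 | h3
      · exact (h1 _ (hi.monotone h3) _).le
      · exact (h2 _ (hj.monotone h3) _).le
    by_cases h5 : x₀ < Z t ω
    · rw [indicator_of_mem (s := {ω | x₀ < Z t ω}) h5]
      linarith
    by_cases h6 : y₀ < W t ω
    · rw [indicator_of_mem (s := {ω | y₀ < W t ω}) h6]
      linarith
    rw [hG0 _ (hi.monotone (not_lt.1 h5)) _ (hj.monotone (not_lt.1 h6)), abs_zero]
    positivity
  have := norm_integral_le_of_norm_le (((hint ε hA).add (hint ε hB)).add (hint K hC))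
    (Eventually.of_forall hbound)
  rw [Real.norm_eq_abs] at this
  refine (mul_le_mul_of_nonneg_left this hmt).trans (le_of_eq ?_)
  rw [integral_add' ((hint ε hA).add (hint ε hB)) (hint K hC), integral_add' (hint ε hA) (hint ε hB),
    integral_indicator_const _ hA, integral_indicator_const _ hB, integral_indicator_const _ hC]
  simp only [smul_eq_mul]
  ring

end Plane

/-! ### Test functions on the punctured rectangle and vague convergence. -/

section Punctured

set_option linter.unusedSectionVars false

variable {A B : Type*} [LinearOrder A] [BoundedOrder A] [Nontrivial A]
  [TopologicalSpace A] [OrderTopology A] [CompactSpace A] [SecondCountableTopology A]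
  [MeasurableSpace A] [BorelSpace A]
  [LinearOrder B] [BoundedOrder B] [Nontrivial B]
  [TopologicalSpace B] [OrderTopology B] [CompactSpace B] [SecondCountableTopology B]
  [MeasurableSpace B] [BorelSpace B]
  {i : ℝ → A} {S : Set ℝ} {j : ℝ → B} {T : Set ℝ}

/-- Mass at the removed corner is invisible to functions vanishing there, so integrals can be
computed on the full compact rectangle. -/
lemma integral_comap_punctured (ρ : Measure (A × B)) {F : A × B → ℝ} (hF : F (⊥, ⊥) = 0) :
    ∫ z : {p : A × B // p ≠ (⊥, ⊥)}, F z ∂(ρ.comap Subtype.val) = ∫ p, F p ∂ρ := by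
  have hs : MeasurableSet {p : A × B | p ≠ (⊥, ⊥)} := (measurableSet_singleton _).compl
  refine (integral_subtype_comap (μ := ρ) hs F).trans
    (setIntegral_eq_integral_of_forall_compl_eq_zero fun p hp => ?_)
  have : p = (⊥, ⊥) := by simpa using hp
  rw [this, hF]

/-- A compactly supported function on the punctured rectangle extends continuously by zero, and
the extension vanishes on a box around the removed corner. -/
lemma exists_extension_punctured (hi : IsAxisChart i S) (hj : IsAxisChart j T)
    (f : C_c({p : A × B // p ≠ (⊥, ⊥)}, ℝ)) :
    ∃ F : A × B → ℝ, Continuous F ∧ (∀ z : {p : A × B // p ≠ (⊥, ⊥)}, F z = f z) ∧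
      ∃ x ∈ S, ∃ y ∈ T, ∀ u ≤ i x, ∀ v ≤ j y, F (u, v) = 0 := by
  have hopen : IsOpen {p : A × B | p ≠ (⊥, ⊥)} := isClosed_singleton.isOpen_compl
  refine ⟨Function.extend Subtype.val f 0,
    HasCompactSupport.continuous_extend_zero hopen f.continuous f.hasCompactSupport,
    fun z => Subtype.val_injective.extend_apply _ _ _, ?_⟩
  -- Compactness survives the inclusion, so the image of the support is closed in the rectangle and
  -- stays away from the corner.
  have hK : IsCompact (Subtype.val '' tsupport f : Set (A × B)) :=
    f.hasCompactSupport.isCompact.image continuous_subtype_val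
  have hn : (Subtype.val '' tsupport f : Set (A × B))ᶜ ∈ 𝓝 ((⊥, ⊥) : A × B) := by
    refine hK.isClosed.isOpen_compl.mem_nhds ?_
    rintro ⟨z, -, hz⟩
    exact z.2 hz
  rw [nhds_prod_eq] at hn
  obtain ⟨⟨a, b⟩, ⟨ha, hb⟩, hab⟩ :=
    ((nhds_bot_basis (α := A)).prod (nhds_bot_basis (α := B))).mem_iff.1 hn
  obtain ⟨x, hx, hxa⟩ := hi.exists_lt a ha
  obtain ⟨y, hy, hyb⟩ := hj.exists_lt b hb
  refine ⟨x, hx, y, hy, fun u hu v hv => ?_⟩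
  have hnot : (u, v) ∉ (Subtype.val '' tsupport f : Set (A × B)) :=
    hab ⟨hu.trans_lt hxa, hv.trans_lt hyb⟩
  by_cases h : (u, v) = ((⊥, ⊥) : A × B)
  · rw [Function.extend_apply', Pi.zero_apply]
    rintro ⟨z, hz⟩
    exact z.2 (hz.trans h)
  · have := Subtype.val_injective.extend_apply f 0 (⟨(u, v), h⟩ : {p : A × B // p ≠ (⊥, ⊥)})
    refine this.trans (image_eq_zero_of_notMem_tsupport fun hz => hnot ⟨_, hz, rfl⟩)

/-- Urysohn's lemma between a quadrant and the strips below two strictly lower levels. The support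
lies in the larger closed quadrant, which is compact and misses the corner; the bump thus dominates
a joint exceedance while vanishing on both axes. -/
lemma exists_bump_punctured (hi : IsAxisChart i S) (hj : IsAxisChart j T) {x y : ℝ} (hx : x ∈ S)
    (hy : y ∈ T) :
    ∃ (f : C_c({p : A × B // p ≠ (⊥, ⊥)}, ℝ)) (F : A × B → ℝ), Continuous F ∧
      (∀ z : {p : A × B // p ≠ (⊥, ⊥)}, f z = F z) ∧ (∀ p, 0 ≤ F p) ∧
      (∀ v, F (⊥, v) = 0) ∧ (∀ u, F (u, ⊥) = 0) ∧ ∀ u ≥ i x, ∀ v ≥ j y, F (u, v) = 1 := by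
  obtain ⟨x', hx', hxx⟩ := hi.exists_lt _ (hi.bot_lt x hx)
  obtain ⟨y', hy', hyy⟩ := hj.exists_lt _ (hj.bot_lt y hy)
  have hD : IsClosed {p : A × B | p.1 ≤ i x' ∨ p.2 ≤ j y'} :=
    (isClosed_le continuous_fst continuous_const).union
      (isClosed_le continuous_snd continuous_const)
  have hC : IsClosed {p : A × B | i x ≤ p.1 ∧ j y ≤ p.2} :=
    (isClosed_le continuous_const continuous_fst).inter
      (isClosed_le continuous_const continuous_snd)
  have hK : IsClosed {p : A × B | i x' ≤ p.1 ∧ j y' ≤ p.2} :=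
    (isClosed_le continuous_const continuous_fst).inter
      (isClosed_le continuous_const continuous_snd)
  have hdisj : Disjoint {p : A × B | p.1 ≤ i x' ∨ p.2 ≤ j y'} {p | i x ≤ p.1 ∧ j y ≤ p.2} := by
    rw [Set.disjoint_left]
    rintro p (h | h) ⟨h1, h2⟩
    · exact absurd (h1.trans h) (not_le.2 hxx)
    · exact absurd (h2.trans h) (not_le.2 hyy)
  obtain ⟨F, hF0, hF1, hF⟩ := exists_continuous_zero_one_of_isClosed hD hC hdisj
  have hsupp : HasCompactSupport fun z : {p : A × B // p ≠ (⊥, ⊥)} => F z := by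
    refine HasCompactSupport.intro (K := Subtype.val ⁻¹' {p : A × B | i x' ≤ p.1 ∧ j y' ≤ p.2})
      (Topology.IsInducing.subtypeVal.isCompact_preimage' hK.isCompact ?_) fun z hz => hF0 ?_
    · rintro p ⟨h1, -⟩
      refine ⟨⟨p, ?_⟩, rfl⟩
      rintro rfl
      exact absurd h1 (not_le.2 (hi.bot_lt x' hx'))
    · have : ¬ (i x' ≤ z.1.1 ∧ j y' ≤ z.1.2) := hz
      rw [not_and_or, not_le, not_le] at this
      exact this.imp le_of_lt le_of_lt
  exact ⟨⟨⟨fun z => F z, F.continuous.comp continuous_subtype_val⟩, hsupp⟩, F, F.continuous,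
    fun _ => rfl, fun p => (hF p).1, fun v => hF0 (Or.inl bot_le), fun u => hF0 (Or.inr bot_le),
    fun u hu v hv => hF1 ⟨hu, hv⟩⟩

variable {Ω ι : Type*} [MeasurableSpace Ω] {P : Measure Ω} [IsProbabilityMeasure P] {l : Filter ι}
  {m : ι → ℝ} {Z W : ι → Ω → ℝ} {μ ν : Measure ℝ}

lemma integral_scaledLaw (hi : Continuous i) (hj : Continuous j) {Z W : Ω → ℝ}
    (hZ : Measurable Z) (hW : Measurable W) {c : ℝ} (hc : 0 ≤ c) {F : A × B → ℝ}
    (hF : Continuous F) (hF0 : F (⊥, ⊥) = 0) :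
    ∫ z : {p : A × B // p ≠ (⊥, ⊥)}, F z ∂(ENNReal.ofReal c •
      (P.map (fun ω => (i (Z ω), j (W ω)))).comap Subtype.val) =
      c * ∫ ω, F (i (Z ω), j (W ω)) ∂P := by
  rw [integral_smul_measure, integral_comap_punctured _ hF0, ENNReal.toReal_ofReal hc, smul_eq_mul,
    integral_map (φ := fun ω => (i (Z ω), j (W ω)))
      ((hi.measurable.comp hZ).prodMk (hj.measurable.comp hW)).aemeasurable hF.stronglyMeasurable.aestronglyMeasurable]

lemma integral_axesMeasure (hi : IsAxisChart i S) (hj : IsAxisChart j T) {F : A × B → ℝ}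
    (hF : Continuous F) {x y : ℝ} (hx : μ (Ioi x) ≠ ∞) (hy : ν (Ioi y) ≠ ∞)
    (hF0 : ∀ u ≤ i x, ∀ v ≤ j y, F (u, v) = 0) :
    ∫ z : {p : A × B // p ≠ (⊥, ⊥)}, F z ∂((μ.map (fun x => (i x, (⊥ : B))) +
      ν.map (fun y => ((⊥ : A), j y))).comap Subtype.val) =
      (∫ x, F (i x, ⊥) ∂μ) + ∫ y, F (⊥, j y) ∂ν := by
  have hm1 : AEMeasurable (fun x => (i x, (⊥ : B))) μ :=
    (hi.continuous.measurable.prodMk measurable_const).aemeasurable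
  have hm2 : AEMeasurable (fun y => ((⊥ : A), j y)) ν :=
    (measurable_const.prodMk hj.continuous.measurable).aemeasurable
  have hs := hF.stronglyMeasurable
  have h1 : Integrable (fun x => F (i x, ⊥)) μ :=
    hi.integrable (F := fun u => F (u, ⊥)) (by fun_prop) (fun u hu => hF0 u hu _ bot_le) hx
  have h2 : Integrable (fun y => F (⊥, j y)) ν :=
    hj.integrable (F := fun v => F (⊥, v)) (by fun_prop) (fun v hv => hF0 _ bot_le v hv) hy
  rw [integral_comap_punctured _ (hF0 _ bot_le _ bot_le), integral_add_measure,
    integral_map hm1 hs.aestronglyMeasurable, integral_map hm2 hs.aestronglyMeasurable]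
  · rwa [integrable_map_measure hs.aestronglyMeasurable hm1]
  · rwa [integrable_map_measure hs.aestronglyMeasurable hm2]

/-- When the scaled marginal tails converge, vague convergence to the measure concentrated on the
axes is equivalent to the negligibility of joint exceedances. -/
theorem tendstoVaguely_axes_iff [l.IsCountablyGenerated]
    (hi : IsAxisChart i S) (hj : IsAxisChart j T)
    (hZ : ∀ t, Measurable (Z t)) (hW : ∀ t, Measurable (W t)) (hm : ∀ᶠ t in l, 0 ≤ m t)
    (hμ0 : ∀ x ∈ S, μ (Ioi x) ≠ 0) (hμ : ∀ x ∈ S, μ (Ioi x) ≠ ∞)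
    (hν0 : ∀ x ∈ T, ν (Ioi x) ≠ 0) (hν : ∀ x ∈ T, ν (Ioi x) ≠ ∞)
    (hX : ∀ x ∈ S, Tendsto (fun t => m t * P.real {ω | x < Z t ω}) l (𝓝 (μ.real (Ioi x))))
    (hY : ∀ y ∈ T, Tendsto (fun t => m t * P.real {ω | y < W t ω}) l (𝓝 (ν.real (Ioi y)))) :
    TendstoVaguely (E := {p : A × B // p ≠ (⊥, ⊥)})
      (fun t => ENNReal.ofReal (m t) •
        (P.map (fun ω => (i (Z t ω), j (W t ω)))).comap Subtype.val) l
      ((μ.map (fun x => (i x, (⊥ : B))) + ν.map (fun y => ((⊥ : A), j y))).comap Subtype.val) ↔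
    ∀ x ∈ S, ∀ y ∈ T,
      Tendsto (fun t => m t * P.real {ω | x < Z t ω ∧ y < W t ω}) l (𝓝 0) := by
  have hint : ∀ {F : A × B → ℝ}, Continuous F → ∀ t,
      Integrable (fun ω => F (i (Z t ω), j (W t ω))) P := by
    intro F hF t
    obtain ⟨K, hK⟩ := isCompact_univ.exists_bound_of_continuousOn hF.continuousOn
    refine Integrable.of_bound (hF.measurable.comp ((hi.continuous.measurable.comp (hZ t)).prodMk
      (hj.continuous.measurable.comp (hW t)))).aestronglyMeasurable K
      (Eventually.of_forall fun ω => hK _ (mem_univ _))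
  constructor
  · intro h x hx y hy
    obtain ⟨f, F, hF, hfF, hF0, hFb1, hFb2, hF1⟩ := exists_bump_punctured hi hj hx hy
    have key := h f
    have hlim : ∫ z, f z ∂((μ.map (fun x => (i x, (⊥ : B))) +
        ν.map (fun y => ((⊥ : A), j y))).comap Subtype.val) = 0 := by
      simp_rw [hfF]
      rw [integral_comap_punctured _ (hFb1 _)]
      refine integral_eq_zero_of_ae ?_
      have hz : MeasurableSet {p | F p = 0} := hF.measurable (measurableSet_singleton 0)
      rw [Filter.EventuallyEq, ae_add_measure_iff]
      constructor
      · exact (ae_map_iff (hi.continuous.measurable.prodMk measurable_const).aemeasurable hz).2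
          (Eventually.of_forall fun x => hFb2 _)
      · exact (ae_map_iff (measurable_const.prodMk hj.continuous.measurable).aemeasurable hz).2
          (Eventually.of_forall fun x => hFb1 _)
    rw [hlim] at key
    refine tendsto_of_tendsto_of_tendsto_of_le_of_le' tendsto_const_nhds key ?_ ?_
    · filter_upwards [hm] with t ht
      positivity
    · filter_upwards [hm] with t ht
      simp_rw [hfF]
      rw [integral_scaledLaw hi.continuous hj.continuous (hZ t) (hW t) ht hF (hFb1 _)]
      refine mul_le_mul_of_nonneg_left ?_ ht
      have hms : MeasurableSet {ω | x < Z t ω ∧ y < W t ω} :=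
        (measurableSet_lt measurable_const (hZ t)).inter
          (measurableSet_lt measurable_const (hW t))
      rw [← integral_indicator_one hms]
      refine integral_mono ((integrable_const (1 : ℝ)).indicator hms) (hint hF t) fun ω => ?_
      by_cases hω : ω ∈ {ω | x < Z t ω ∧ y < W t ω}
      · rw [indicator_of_mem hω]
        simp only [Pi.one_apply]
        rw [hF1 _ (hi.monotone hω.1.le) _ (hj.monotone hω.2.le)]
      · rw [indicator_of_notMem hω]
        exact hF0 _
  · intro h f
    obtain ⟨F, hF, hFf, x, hx, y, hy, hF0⟩ := exists_extension_punctured hi hj f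
    simp_rw [← hFf]
    rw [integral_axesMeasure hi hj hF (hμ x hx) (hν y hy) hF0]
    have hc : F (⊥, ⊥) = 0 := hF0 _ bot_le _ bot_le
    have h1 := hi.tendsto_mul_integral hZ hμ0 hμ hX (F := fun u => F (u, ⊥)) (by fun_prop) hx
      fun u hu => hF0 u hu _ bot_le
    have h2 := hj.tendsto_mul_integral hW hν0 hν hY (F := fun v => F (⊥, v)) (by fun_prop) hy
      fun v hv => hF0 _ bot_le v hv
    -- Subtracting both axis restrictions leaves only the corner value on either axis, up to sign,
    -- and `hc` makes that zero.
    have h3 := tendsto_mul_integral_zero_of_joint hi hj hZ hW hm (hX x hx) (hY y hy) h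
      (G := fun p => F p - F (p.1, ⊥) - F (⊥, p.2)) (by fun_prop) (by simp [hc]) (by simp [hc])
      (fun u hu v hv => by
        simp [hF0 u hu v hv, hF0 u hu _ bot_le, hF0 _ bot_le v hv])
    have h4 := (h1.add h2).add h3
    rw [add_zero] at h4
    refine h4.congr' ?_
    filter_upwards [hm] with t ht
    rw [integral_scaledLaw hi.continuous hj.continuous (hZ t) (hW t) ht hF hc]
    have i0 := hint hF t
    have i1 := hint (F := fun p => F (p.1, ⊥)) (by fun_prop) t
    have i2 := hint (F := fun p => F (⊥, p.2)) (by fun_prop) t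
    simp only at i1 i2
    have e1 : ∫ ω, (F (i (Z t ω), j (W t ω)) - F (i (Z t ω), ⊥) - F (⊥, j (W t ω))) ∂P =
        (∫ ω, F (i (Z t ω), j (W t ω)) ∂P) - (∫ ω, F (i (Z t ω), ⊥) ∂P) -
          ∫ ω, F (⊥, j (W t ω)) ∂P := 
      (integral_sub (i0.sub i1) i2).trans (by rw [← integral_sub i0 i1]; rfl)
    rw [e1]
    ring

end Punctured

/-! ### Tail quantiles. -/

section Quantile

variable {Ω : Type*} [MeasurableSpace Ω] {P : Measure Ω} [IsProbabilityMeasure P] {X : Ω → ℝ}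

lemma measureReal_lt_eq_one_sub_cdf (hX : Measurable X) (s : ℝ) :
    P.real {ω | s < X ω} = 1 - cdf (P.map X) s := by
  have : IsProbabilityMeasure (P.map X) := Measure.isProbabilityMeasure_map hX.aemeasurable
  rw [cdf_eq_real, ← probReal_compl_eq_one_sub measurableSet_Iic, compl_Iic,
    map_measureReal_apply hX measurableSet_Ioi]
  rfl

lemma measureReal_lt_antitone (P : Measure Ω) [IsProbabilityMeasure P] (X : Ω → ℝ) :
    Antitone fun s : ℝ => P.real {ω | s < X ω} :=
  fun _ _ h => measureReal_mono fun _ hω => lt_of_le_of_lt h hω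

lemma tendsto_measureReal_lt_atTop (hX : Measurable X) :
    Tendsto (fun s : ℝ => P.real {ω | s < X ω}) atTop (𝓝 0) := by
  simp_rw [measureReal_lt_eq_one_sub_cdf hX]
  simpa using (tendsto_cdf_atTop (P.map X)).const_sub 1

lemma tendsto_measureReal_lt_atBot (hX : Measurable X) :
    Tendsto (fun s : ℝ => P.real {ω | s < X ω}) atBot (𝓝 1) := by
  simp_rw [measureReal_lt_eq_one_sub_cdf hX]
  simpa using (tendsto_cdf_atBot (P.map X)).const_sub 1

lemma tendsto_measureReal_lt_nhdsGT (hX : Measurable X) (q : ℝ) :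
    Tendsto (fun s : ℝ => P.real {ω | s < X ω}) (𝓝[>] q) (𝓝 (P.real {ω | q < X ω})) := by
  simp_rw [measureReal_lt_eq_one_sub_cdf hX]
  exact (((cdf (P.map X)).right_continuous q).tendsto.mono_left
    (nhdsWithin_mono _ Ioi_subset_Ici_self)).const_sub 1

/-- The product form also covers a null tail, where the reciprocal is `∞` and both sides hold. -/
lemma ofReal_lt_tailRecip_iff (hX : Measurable X) {x : ℝ} (hx : 0 < x) (s : ℝ) :
    ENNReal.ofReal x < tailRecip P X s ↔ x * P.real {ω | s < X ω} < 1 := by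
  have h1 : 1 - P {ω | X ω ≤ s} = ENNReal.ofReal (P.real {ω | s < X ω}) := by
    rw [← prob_compl_eq_one_sub (measurableSet_le hX measurable_const), ofReal_measureReal]
    congr 1
    ext ω
    simp
  rw [tailRecip, h1, one_div, ENNReal.lt_inv_iff_lt_inv, ← ENNReal.ofReal_inv_of_pos hx,
    ENNReal.ofReal_lt_ofReal_iff (inv_pos.2 hx), ← one_div, lt_div_iff₀ hx, mul_comm]

lemma le_tailQuantile (hX : Measurable X) {x s : ℝ} (hx : 0 < x)
    (h : 1 ≤ x * P.real {ω | s < X ω}) : s ≤ tailQuantile P X x := by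
  -- Needed because `sInf ∅ = 0` in `ℝ`.
  have hne : {r : ℝ | ENNReal.ofReal x < tailRecip P X r}.Nonempty := by
    have hlim := (tendsto_measureReal_lt_atTop (P := P) hX).const_mul x
    rw [mul_zero] at hlim
    obtain ⟨r, hr⟩ := (hlim.eventually_lt_const zero_lt_one).exists
    exact ⟨r, (ofReal_lt_tailRecip_iff hX hx r).2 hr⟩
  refine le_csInf hne fun r hr => ?_
  by_contra! hlt
  have h1 := (ofReal_lt_tailRecip_iff hX hx r).1 hr
  have h2 := mul_le_mul_of_nonneg_left (measureReal_lt_antitone P X hlt.le) hx.le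
  simp only at h2
  linarith

lemma tailQuantile_le (hX : Measurable X) {x s : ℝ} (hx : 1 < x)
    (h : x * P.real {ω | s < X ω} < 1) : tailQuantile P X x ≤ s := by
  have hx0 := zero_lt_one.trans hx
  -- This is where `1 < x` enters: tails tend to `1` at `-∞`, so very low points violate the
  -- defining inequality. Without a lower bound `sInf` would default to `0`.
  have hbdd : BddBelow {r : ℝ | ENNReal.ofReal x < tailRecip P X r} := by
    have hlim := (tendsto_measureReal_lt_atBot (P := P) hX).const_mul x
    rw [mul_one] at hlim
    obtain ⟨r, hr⟩ := (hlim.eventually_const_lt hx).exists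
    refine ⟨r, fun s hs => ?_⟩
    by_contra! hlt
    have h1 := (ofReal_lt_tailRecip_iff hX hx0 s).1 hs
    have h2 := mul_le_mul_of_nonneg_left (measureReal_lt_antitone P X hlt.le) hx0.le
    simp only at h2
    linarith
  exact csInf_le hbdd ((ofReal_lt_tailRecip_iff hX hx0 s).2 h)

/-- The inequality holds strictly to the right of the quantile and passes to it by right continuity
of the tail. An atom at the quantile can make it strict. -/
lemma mul_measureReal_tailQuantile_le (hX : Measurable X) {x : ℝ} (hx : 0 < x) :
    x * P.real {ω | tailQuantile P X x < X ω} ≤ 1 := by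
  refine le_of_tendsto ((tendsto_measureReal_lt_nhdsGT hX _).const_mul x) ?_
  filter_upwards [self_mem_nhdsWithin] with r hr
  by_contra! hlt
  exact absurd (le_tailQuantile hX hx hlt.le) (not_le.2 hr)

lemma tendsto_tailQuantile_atTop (hX : Measurable X)
    (hpos : ∀ᶠ s in atTop, 0 < P.real {ω | s < X ω}) :
    Tendsto (tailQuantile P X) atTop atTop := by
  refine tendsto_atTop.2 fun r => ?_
  obtain ⟨s, hs, hrs⟩ := (hpos.and (eventually_ge_atTop r)).exists
  filter_upwards [eventually_gt_atTop 0, eventually_ge_atTop (P.real {ω | s < X ω})⁻¹] with x hx hxs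
  refine hrs.trans (le_tailQuantile hX hx ?_)
  rwa [inv_le_iff_one_le_mul₀ hs] at hxs

end Quantile

/-! ### Regular variation along the asymptotic inverse. -/

section Normalization

/-- Monotonicity replaces uniform convergence: `f (s t)` is compared with `f (t * y)` for fixed `y`
slightly above or below `1`. -/
lemma IsRegularlyVarying.tendsto_div_of_isEquivalent {f : ℝ → ℝ} {ρ : ℝ}
    (hf : IsRegularlyVarying f ρ) (hanti : Antitone f) {s : ℝ → ℝ}
    (hs : s ~[atTop] fun t => t) : Tendsto (fun t => f (s t) / f t) atTop (𝓝 1) := by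
  have hst : Tendsto (fun t => s t / t) atTop (𝓝 1) :=
    (isEquivalent_iff_tendsto_one (eventually_ne_atTop 0)).1 hs
  have hcont : Tendsto (fun y : ℝ => y ^ ρ) (𝓝 1) (𝓝 1) := by
    have := (Real.continuousAt_rpow_const 1 ρ (Or.inl one_ne_zero)).tendsto
    rwa [Real.one_rpow] at this
  have hpos : ∀ᶠ y : ℝ in 𝓝 1, 0 < y := lt_mem_nhds one_pos
  refine tendsto_order.2 ⟨fun c hc => ?_, fun c hc => ?_⟩
  · obtain ⟨y, ⟨hy, hy0⟩, hy1⟩ :=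
      ((eventually_nhdsWithin_of_eventually_nhds ((hcont.eventually_const_lt hc).and hpos)).and
        (eventually_mem_nhdsWithin (s := Ioi (1 : ℝ)))).exists
    filter_upwards [(hf.2 y hy0).eventually_const_lt hy, hst.eventually_lt_const hy1, hf.1,
      eventually_gt_atTop 0] with t h1 h2 h3 h4
    refine h1.trans_le (div_le_div_of_nonneg_right (hanti ?_) h3.le)
    rw [div_lt_iff₀ h4] at h2
    linarith
  · obtain ⟨y, ⟨hy, hy0⟩, hy1⟩ :=
      ((eventually_nhdsWithin_of_eventually_nhds ((hcont.eventually_lt_const hc).and hpos)).and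
        (eventually_mem_nhdsWithin (s := Iio (1 : ℝ)))).exists
    filter_upwards [(hf.2 y hy0).eventually_lt_const hy, hst.eventually_const_lt hy1, hf.1,
      eventually_gt_atTop 0] with t h1 h2 h3 h4
    refine lt_of_le_of_lt (div_le_div_of_nonneg_right (hanti ?_) h3.le) h1
    rw [lt_div_iff₀ h4] at h2
    linarith

variable {d : ℕ → ℝ} {d' : ℝ → ℝ}

/-- Finitely many values of `d` are bounded, while `d ⌊d' t⌋₊` tends to infinity, so the index must
leave every finite range. -/
lemma tendsto_floor_asymptoticInverse (h : (fun t : ℝ => d ⌊d' t⌋₊) ~[atTop] (fun t => t)) :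
    Tendsto (fun t => ⌊d' t⌋₊) atTop atTop := by
  have h1 : Tendsto (fun t : ℝ => d ⌊d' t⌋₊) atTop atTop := h.symm.tendsto_atTop tendsto_id
  refine tendsto_atTop.2 fun N => ?_
  obtain ⟨M, hM⟩ := ((Finset.range N).image d).bddAbove
  filter_upwards [h1.eventually_gt_atTop M] with t ht
  by_contra! hlt
  exact absurd (hM (Finset.mem_coe.2 (Finset.mem_image_of_mem d (Finset.mem_range.2 hlt))))
    (not_le.2 ht)

lemma tendsto_asymptoticInverse (h : (fun t : ℝ => d ⌊d' t⌋₊) ~[atTop] (fun t => t)) :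
    Tendsto d' atTop atTop := by
  refine tendsto_atTop.2 fun c => ?_
  filter_upwards [(tendsto_floor_asymptoticInverse h).eventually_ge_atTop (⌈c⌉₊ + 1)] with t ht
  rw [Nat.le_floor_iff' (Nat.succ_ne_zero _)] at ht
  push_cast at ht
  linarith [Nat.le_ceil c]

/-- With `n = ⌊d' t⌋₊`, the product factors as `n f(d n)`, `f t / f(d n)`, `d' t / n` and `f(t y) /
f t`; the first three tend to `1`. -/
lemma IsRegularlyVarying.tendsto_asymptoticInverse_mul {f : ℝ → ℝ} {ρ : ℝ}
    (hf : IsRegularlyVarying f ρ) (hanti : Antitone f)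
    (hd : Tendsto (fun n : ℕ => (n : ℝ) * f (d n)) atTop (𝓝 1))
    (h : (fun t : ℝ => d ⌊d' t⌋₊) ~[atTop] (fun t => t)) {y : ℝ} (hy : 0 < y) :
    Tendsto (fun t => d' t * f (t * y)) atTop (𝓝 (y ^ ρ)) := by
  have h1 := hd.comp (tendsto_floor_asymptoticInverse h)
  have h2 := hf.tendsto_div_of_isEquivalent hanti h
  have h3 := (tendsto_nat_floor_div_atTop (R := ℝ)).comp (tendsto_asymptoticInverse h)
  have h4 := ((h1.div h2 one_ne_zero).div h3 one_ne_zero).mul (hf.2 y hy)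
  simp only [div_one, one_mul] at h4
  refine h4.congr' ?_
  filter_upwards [hf.1, (tendsto_asymptoticInverse h).eventually_gt_atTop 0,
    (h2.eventually_const_lt zero_lt_one),
    (tendsto_floor_asymptoticInverse h).eventually_gt_atTop 0] with t h5 h6 h7 h8
  have h9 : f (d ⌊d' t⌋₊) ≠ 0 := by
    intro h0
    rw [h0, zero_div] at h7
    exact lt_irrefl _ h7
  have h10 : (⌊d' t⌋₊ : ℝ) ≠ 0 := Nat.cast_ne_zero.2 h8.ne'
  simp only [Function.comp, Pi.div_apply]
  field_simp

end Normalization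

/-! ### Normalizing levels against quantiles. -/

section Independence

variable {Ω : Type*} [MeasurableSpace Ω] {P : Measure Ω} [IsProbabilityMeasure P] {X Y : Ω → ℝ}

lemma isAsymptoticallyTailIndependent_iff_toReal {Ω : Type*} [MeasurableSpace Ω] {P : Measure Ω}
    {X Y : Ω → ℝ} (hY : Measurable Y) :
    IsAsymptoticallyTailIndependent P X Y ↔
      Tendsto (fun x : ℝ => P.real {ω | tailQuantile P X x < X ω ∧ tailQuantile P Y x < Y ω} /
        P.real {ω | tailQuantile P Y x < Y ω}) atTop (𝓝 0) := by
  rw [IsAsymptoticallyTailIndependent,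
    ← ENNReal.tendsto_toReal_iff (fun x => measure_ne_top _ _) ENNReal.zero_ne_top,
    ENNReal.toReal_zero]
  refine tendsto_congr fun x => ?_
  rw [cond_apply (measurableSet_lt measurable_const hY), ENNReal.toReal_mul, ENNReal.toReal_inv,
    inter_comm, div_eq_inv_mul]
  rfl

/-- Joint exceedances of the normalizing levels are negligible exactly under asymptotic tail
independence. -/
theorem joint_exceedance_iff (hX : Measurable X) (hY : Measurable Y) {α : ℝ}
    (hYpos : ∀ᶠ s in atTop, 0 < P.real {ω | s < Y ω})
    {m a b τ : ℝ → ℝ} {S : Set ℝ} (hm : Tendsto m atTop atTop)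
    (hmY : ∀ y, 0 < y → Tendsto (fun t => m t * P.real {ω | t * y < Y ω}) atTop (𝓝 (y ^ (-α))))
    (hXτ : ∀ x ∈ S,
      Tendsto (fun s => s * P.real {ω | a s * x + b s < X ω}) atTop (𝓝 (τ x)))
    (hτ : ∀ C, ∃ x ∈ S, C < τ x) :
    (∀ x ∈ S, ∀ y ∈ Ioi (0 : ℝ), Tendsto (fun t => m t *
        P.real {ω | a (m t) * x + b (m t) < X ω ∧ t * y < Y ω}) atTop (𝓝 0)) ↔
      IsAsymptoticallyTailIndependent P X Y := by
  rw [isAsymptoticallyTailIndependent_iff_toReal hY]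
  have hq := tendsto_tailQuantile_atTop hY hYpos
  constructor
  · intro h
    -- The constant eventually exceeds `m t * P(Y > t / 2)`. An `X`-level with a larger limiting
    -- scaled tail will fall below the `X`-quantile.
    obtain ⟨x, hx, hCx⟩ := hτ ((1 / 2 : ℝ) ^ (-α) + 1)
    have h1 := (h x hx 1 (mem_Ioi.2 one_pos)).comp hq
    have h2 := (hmY 1 one_pos).comp hq
    rw [Real.one_rpow] at h2
    have h3 := (hmY (1 / 2) (by norm_num)).eventually_lt_const
      (lt_add_one ((1 / 2 : ℝ) ^ (-α)))
    have h4 := (hm.comp hq).eventually ((hXτ x hx).eventually_const_lt hCx)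
    have h5 := h1.div h2 one_ne_zero
    rw [zero_div] at h5
    refine squeeze_zero' (Eventually.of_forall fun s => by positivity) ?_ h5
    filter_upwards [hq.eventually h3, h4, (hm.comp hq).eventually_gt_atTop 0,
      hq.eventually_gt_atTop 0, eventually_gt_atTop 1, h2.eventually_const_lt zero_lt_one]
      with s h6 h7 h8 h9 h10 h11
    simp only [Function.comp, Pi.div_apply, mul_one] at h6 h7 h8 h11 ⊢
    set t := tailQuantile P Y s
    -- An atom of `Y` at the quantile `t` could make `s * P(Y > t)` small, so the lower bound is
    -- taken at `t / 2`, strictly below the quantile. With `h6` it bounds `m t` by a multiple of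
    -- `s`.
    have hs : 1 ≤ s * P.real {ω | t * (1 / 2) < Y ω} := by
      by_contra! hlt
      have := tailQuantile_le hY h10 hlt
      change t ≤ _ at this
      linarith
    have hC : 0 < (1 / 2 : ℝ) ^ (-α) + 1 := by positivity
    have hms : m t ≤ ((1 / 2 : ℝ) ^ (-α) + 1) * s := by
      by_contra! hlt
      have hp : 0 ≤ P.real {ω | t * (1 / 2) < Y ω} := measureReal_nonneg
      nlinarith
    have hXs : a (m t) * x + b (m t) ≤ tailQuantile P X s := by
      refine le_tailQuantile hX (by linarith) ?_
      have hp : 0 ≤ P.real {ω | a (m t) * x + b (m t) < X ω} := measureReal_nonneg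
      have := mul_le_mul_of_nonneg_right hms hp
      by_contra! hlt
      nlinarith
    rw [mul_div_mul_left _ _ h8.ne']
    refine div_le_div_of_nonneg_right (measureReal_mono ?_) measureReal_nonneg
    rintro ω ⟨h12, h13⟩
    exact ⟨hXs.trans_lt h12, h13⟩
  · intro h x hx y hy
    -- At `s = c * m t` both scaled tails at the normalizing levels are eventually below `1`, which
    -- puts the levels at or above the quantiles.
    obtain ⟨c, hc, hc1, hc2⟩ : ∃ c : ℝ, 0 < c ∧ c * τ x < 1 ∧ c * y ^ (-α) < 1 := by
      have hlim : ∀ r : ℝ, ∀ᶠ c in 𝓝[>] (0 : ℝ), c * r < 1 := fun r => by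
        have : Tendsto (fun c : ℝ => c * r) (𝓝[>] 0) (𝓝 (0 * r)) :=
          (tendsto_id.mono_left nhdsWithin_le_nhds).mul_const r
        rw [zero_mul] at this
        exact this.eventually_lt_const one_pos
      exact ((eventually_mem_nhdsWithin (a := (0 : ℝ)) (s := Ioi 0)).and
        ((hlim (τ x)).and (hlim (y ^ (-α))))).exists
    have hs : Tendsto (fun t => c * m t) atTop atTop := hm.const_mul_atTop hc
    have h1 := (h.comp hs).const_mul c⁻¹
    rw [mul_zero] at h1
    have h2 := (((hXτ x hx).comp hm).const_mul c).eventually_lt_const hc1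
    have h3 := ((hmY y hy).const_mul c).eventually_lt_const hc2
    refine squeeze_zero' ?_ ?_ h1
    · filter_upwards [hm.eventually_gt_atTop 0] with t ht
      positivity
    filter_upwards [h2, h3, hs.eventually_gt_atTop 1, hm.eventually_gt_atTop 0]
      with t h4 h5 h6 h7
    simp only [Function.comp] at h4 h5 ⊢
    rw [← mul_assoc] at h4 h5
    have hXq := tailQuantile_le hX h6 h4
    have hYq := tailQuantile_le hY h6 h5
    have hle := mul_measureReal_tailQuantile_le (P := P) hY (zero_lt_one.trans h6)
    have hmono : P.real {ω | a (m t) * x + b (m t) < X ω ∧ t * y < Y ω} ≤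
        P.real {ω | tailQuantile P X (c * m t) < X ω ∧ tailQuantile P Y (c * m t) < Y ω} :=
      measureReal_mono fun ω hω => ⟨hXq.trans_lt hω.1, hYq.trans_lt hω.2⟩
    -- Division by zero would make the conditional probability `0` and the bound empty; eventual
    -- positivity of the tail extends to all points by monotonicity.
    have hBpos : 0 < P.real {ω | tailQuantile P Y (c * m t) < Y ω} := by
      obtain ⟨r, hr, hrs⟩ := (hYpos.and
        (eventually_ge_atTop (tailQuantile P Y (c * m t)))).exists
      exact hr.trans_le (measureReal_lt_antitone P Y hrs)
    refine (mul_le_mul_of_nonneg_left hmono h7.le).trans ?_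
    rw [inv_mul_eq_div, div_div, le_div_iff₀ (by positivity)]
    set N := P.real {ω | tailQuantile P X (c * m t) < X ω ∧ tailQuantile P Y (c * m t) < Y ω}
    have hN : 0 ≤ N := measureReal_nonneg
    nlinarith

end Independence

/-! ### The Gumbel and Fréchet cases. -/

lemma gumbelCDF_pos (x : ℝ) : 0 < gumbelCDF x := Real.exp_pos _

lemma neg_log_gumbelCDF (x : ℝ) : -Real.log (gumbelCDF x) = Real.exp (-x) := by
  rw [gumbelCDF, Real.log_exp, neg_neg]

lemma frechetCDF_pos {β x : ℝ} (hx : 0 < x) : 0 < frechetCDF β x := by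
  rw [frechetCDF, if_pos hx]
  exact Real.exp_pos _

lemma neg_log_frechetCDF {β x : ℝ} (hx : 0 < x) : -Real.log (frechetCDF β x) = x ^ (-β) := by
  rw [frechetCDF, if_pos hx, Real.log_exp, neg_neg]

lemma exists_lt_exp_neg (C : ℝ) : ∃ x ∈ (univ : Set ℝ), C < Real.exp (-x) :=
  ⟨-C, mem_univ _, by rw [neg_neg]; linarith [Real.add_one_le_exp C]⟩

lemma exists_lt_rpow_neg {β : ℝ} (hβ : 0 < β) (C : ℝ) : ∃ x ∈ Ioi (0 : ℝ), C < x ^ (-β) :=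
  (((tendsto_rpow_neg_nhdsGT_zero (neg_neg_of_pos hβ)).eventually_gt_atTop C).and eventually_mem_nhdsWithin).exists.imp
    fun _ h => ⟨h.2, h.1⟩

/-- Vague convergence on a rectangle without its lower corner, with the second axis `[0,∞]`, is
equivalent to asymptotic tail independence. -/
theorem tendstoVaguely_axes_iff_tailIndependent {A : Type*} [LinearOrder A] [BoundedOrder A]
    [Nontrivial A] [TopologicalSpace A] [OrderTopology A] [CompactSpace A]
    [SecondCountableTopology A] [MeasurableSpace A] [BorelSpace A] {i : ℝ → A} {S : Set ℝ}
    (hi : IsAxisChart i S) {Ω : Type*} [MeasurableSpace Ω] {P : Measure Ω} [IsProbabilityMeasure P]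
    {X Y : Ω → ℝ} (hX : Measurable X) (hY : Measurable Y) {α : ℝ} (hα : 0 < α)
    (hYpos : ∀ᶠ s in atTop, 0 < P.real {ω | s < Y ω})
    {m a b τ : ℝ → ℝ} (hm : Tendsto m atTop atTop) (ha : ∀ᶠ s in atTop, 0 < a s)
    (hmY : ∀ y, 0 < y → Tendsto (fun t => m t * P.real {ω | t * y < Y ω}) atTop (𝓝 (y ^ (-α))))
    (hXτ : ∀ x ∈ S,
      Tendsto (fun s => s * P.real {ω | a s * x + b s < X ω}) atTop (𝓝 (τ x)))
    (hτ : ∀ C, ∃ x ∈ S, C < τ x) (hτ0 : ∀ x ∈ S, 0 < τ x)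
    {μ : Measure ℝ} (hμ : ∀ x ∈ S, μ (Ioi x) = ENNReal.ofReal (τ x)) :
    TendstoVaguely (E := {p : A × ℝ≥0∞ // p ≠ (⊥, ⊥)})
      (fun t => ENNReal.ofReal (m t) •
        (P.map (fun ω => (i ((X ω - b (m t)) / a (m t)), ENNReal.ofReal (Y ω / t)))).comap
          Subtype.val) atTop
      ((μ.map (fun x => (i x, (⊥ : ℝ≥0∞))) +
        (powerMeasure α).map (fun y => ((⊥ : A), ENNReal.ofReal y))).comap Subtype.val) ↔
    IsAsymptoticallyTailIndependent P X Y := by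
  have hXset : ∀ᶠ t in atTop, ∀ x ω,
      x < (X ω - b (m t)) / a (m t) ↔ a (m t) * x + b (m t) < X ω := by
    filter_upwards [hm.eventually ha] with t ht x ω
    rw [lt_div_iff₀ ht, lt_sub_iff_add_lt, mul_comm]
  have hYset : ∀ᶠ t : ℝ in atTop, ∀ y ω, y < Y ω / t ↔ t * y < Y ω := by
    filter_upwards [eventually_gt_atTop 0] with t ht y ω
    rw [lt_div_iff₀ ht, mul_comm]
  rw [← joint_exceedance_iff hX hY hYpos hm hmY hXτ hτ,
    tendstoVaguely_axes_iff hi isAxisChart_ennreal (Z := fun t ω => (X ω - b (m t)) / a (m t))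
      (W := fun t ω => Y ω / t) (fun t => (hX.sub_const _).div_const _) (fun t => hY.div_const _)
      (hm.eventually_ge_atTop 0)]
  · refine forall₂_congr fun x _ => forall₂_congr fun y _ => tendsto_congr' ?_
    filter_upwards [hXset, hYset] with t h1 h2
    simp_rw [h1, h2]
  · intro x hx
    rw [hμ x hx]
    exact (ENNReal.ofReal_pos.2 (hτ0 x hx)).ne'
  · intro x hx
    rw [hμ x hx]
    exact ENNReal.ofReal_ne_top
  · intro y hy
    rw [powerMeasure_Ioi hα hy]
    exact (ENNReal.ofReal_pos.2 (Real.rpow_pos_of_pos hy _)).ne'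
  · intro y hy
    rw [powerMeasure_Ioi hα hy]
    exact ENNReal.ofReal_ne_top
  · intro x hx
    rw [measureReal_def, hμ x hx, ENNReal.toReal_ofReal (hτ0 x hx).le]
    refine ((hXτ x hx).comp hm).congr' ?_
    filter_upwards [hXset] with t h1
    simp_rw [h1]
    rfl
  · intro y hy
    rw [measureReal_def, powerMeasure_Ioi hα hy,
      ENNReal.toReal_ofReal (Real.rpow_pos_of_pos hy _).le]
    refine (hmY y hy).congr' ?_
    filter_upwards [hYset] with t h1
    simp_rw [h1]

end TailIndependence

theorem mainTheorem3 {Ω : Type*} [MeasurableSpace Ω] (P : Measure Ω) [IsProbabilityMeasure P]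
    (X Y : Ω → ℝ) (hX : Measurable X) (hY : Measurable Y) (hY0 : ∀ᵐ ω ∂P, 0 ≤ Y ω)
    (α : ℝ) (hα0 : 0 < α) (hα1 : α < 1)
    (hYα : TailIndependence.IsRegularlyVarying (fun y => P.real {ω | y < Y ω}) (-α))
    (d : ℕ → ℝ) (hd0 : d 0 = 0) (hdpos : ∀ n, 1 ≤ n → 0 < d n)
    (hd : Tendsto (fun n : ℕ => (n : ℝ) * P.real {ω | d n < Y ω}) atTop (𝓝 1))
    (d' : ℝ → ℝ)
    (hdd' : (fun t : ℝ => d ⌊d' t⌋₊) ~[atTop] (fun t => t))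
    (hd'd : (fun t : ℝ => d' (d ⌊t⌋₊)) ~[atTop] (fun t => t))
    (a b : ℝ → ℝ) :
    (TailIndependence.IsMDANorming P X TailIndependence.gumbelCDF a b →
      (TailIndependence.TendstoVaguely
          (fun t : ℝ => TailIndependence.gumbelScaledLaw P (d' t)
            (fun ω => (X ω - b (d' t)) / a (d' t)) (fun ω => Y ω / t))
          atTop (TailIndependence.gumbelExponentMeasure α) ↔
        TailIndependence.IsAsymptoticallyTailIndependent P X Y)) ∧
    (∀ β : ℝ, 0 < β → TailIndependence.IsMDANorming P X (TailIndependence.frechetCDF β) a b →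
      (TailIndependence.TendstoVaguely
          (fun t : ℝ => TailIndependence.frechetScaledLaw P (d' t)
            (fun ω => (X ω - b (d' t)) / a (d' t)) (fun ω => Y ω / t))
          atTop (TailIndependence.frechetExponentMeasure β α) ↔
        TailIndependence.IsAsymptoticallyTailIndependent P X Y)) := by
  have hm := TailIndependence.tendsto_asymptoticInverse hdd'
  have hmY := fun (y : ℝ) (hy : 0 < y) => hYα.tendsto_asymptoticInverse_mul
    (TailIndependence.measureReal_lt_antitone P Y) hd hdd' hy
  constructor
  · rintro ⟨ha, hXG⟩
    -- The concrete scaled laws and exponent measures unfold to the general axis form, with `0 :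
    -- ℝ≥0∞` definitionally the bottom element.
    exact TailIndependence.tendstoVaguely_axes_iff_tailIndependent
      TailIndependence.isAxisChart_ereal hX hY hα0 hYα.1 hm ha hmY
      (fun x _ => TailIndependence.neg_log_gumbelCDF x ▸ hXG x (TailIndependence.gumbelCDF_pos x))
      TailIndependence.exists_lt_exp_neg (fun x _ => Real.exp_pos _)
      (fun x _ => TailIndependence.expMeasure_Ioi x)
  · rintro β hβ ⟨ha, hXG⟩
    exact TailIndependence.tendstoVaguely_axes_iff_tailIndependent
      TailIndependence.isAxisChart_ennreal hX hY hα0 hYα.1 hm ha hmY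
      (fun x hx => TailIndependence.neg_log_frechetCDF hx ▸
        hXG x (TailIndependence.frechetCDF_pos hx))
      (TailIndependence.exists_lt_rpow_neg hβ) (fun x hx => Real.rpow_pos_of_pos hx _)
      (fun x hx => TailIndependence.powerMeasure_Ioi hβ hx)
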